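/- For polynomials $p, q \in \mathbb{C}[x,y]$ let $\deg$ denote the total degree and let $D(p,q) = \frac{\partial p}{\partial x}\frac{\partial q}{\partial y} - \frac{\partial p}{\partial y}\frac{\partial q}{\partial x}$ be the determinant of the Jacobian matrix of $(p,q)$. Call the pair $(p,q)$ elementary reduced if the sum $\deg p + \deg q$ cannot be made smaller by a single transformation of one of the following kinds: a non-degenerate linear transformation $(p,q) \mapsto (ap+bq,\, cp+dq)$ with $a,b,c,d \in \mathbb{C}$, $ad-bc \neq 0$; a transformation $(p,q) \mapsto (p + \mu q^{j},\, q)$ with $\mu \in \mathbb{C}^\ast$, $j \geq 2$; or a transformation $(p,q) \mapsto (p,\, q + \mu p^{j})$ with $\mu \in \mathbb{C}^\ast$, $j \geq 2$. Lemma. Let $p, q \in \mathbb{C}[x,y]$ be algebraically independent over $\mathbb{C}$ such that the pair $(p,q)$ is elementary reduced. Let $n = \deg p$ and $m = \deg q$ with $2 \leq n < m$, and let $k \geq 0$ be an integer with $\deg D(p,q) \geq k$. Let $w \in \mathbb{C}[p,q]$, and suppose that $w$ is not of the form $ap + bq + c$ with $a, b, c \in \mathbb{C}$. Then $\deg w >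 \min(n,k)$. -/

import Mathlib

open MvPolynomial

/-- The determinant `D(p, q)` of the Jacobian matrix of the pair `(p, q)` of polynomials in two
variables (`x = X 0`, `y = X 1`). -/
noncomputable def jacobianDet {K : Type*} [Field K] (p q : MvPolynomial (Fin 2) K) :
    MvPolynomial (Fin 2) K :=
  Matrix.det !![pderiv 0 p, pderiv 1 p; pderiv 0 q, pderiv 1 q]

/-- One admissible transformation `(p, q) ⟶ (p', q')`: a non-degenerate linear transformation, or
an elementary transformation adding to one entry a nonzero multiple of a power (exponent at
least 2) of the other entry. -/
inductive ElementaryStep {K : Type*} [Field K] :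
    MvPolynomial (Fin 2) K × MvPolynomial (Fin 2) K →
    MvPolynomial (Fin 2) K × MvPolynomial (Fin 2) K → Prop
  | linear (p q : MvPolynomial (Fin 2) K) (a b c d : K) (h : a * d - b * c ≠ 0) :
      ElementaryStep (p, q) (a • p + b • q, c • p + d • q)
  | left (p q : MvPolynomial (Fin 2) K) (μ : K) (hμ : μ ≠ 0) (k : ℕ) (hk : 2 ≤ k) :
      ElementaryStep (p, q) (p + μ • q ^ k, q)
  | right (p q : MvPolynomial (Fin 2) K) (μ : K) (hμ : μ ≠ 0) (k : ℕ) (hk : 2 ≤ k) :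
      ElementaryStep (p, q) (p, q + μ • p ^ k)

/-- The pair `(p, q)` is elementary reduced: no single admissible transformation lowers the sum
of the degrees. -/
def IsElementaryReduced {K : Type*} [Field K] (p q : MvPolynomial (Fin 2) K) : Prop :=
  ∀ p' q' : MvPolynomial (Fin 2) K, ElementaryStep (p, q) (p', q') →
    p.totalDegree + q.totalDegree ≤ p'.totalDegree + q'.totalDegree

/-! ### Multiplicity of nonzero roots of sparse polynomials -/

/-!
Write `n = deg p ≤ m = deg q`, let `P`, `Q` be the leading forms of `p`, `q`, and let `w = G(p, q)`.
Give the variables of `G` the weights `n` and `m`, and let `G` have weighted degree `W` and leading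
form `T`. If `w` is not affine in `p` and `q`, then `W ≥ 2n`, so only a drop of `deg w` below `W`,
which forces `T(P, Q) = 0`, can make `deg w` small.

The drop is controlled by the multiplicity `k` of `Q` as a root of `T(P, Y)`. On the one hand,
`∂ᵏG/∂yᵏ (p, q)` has degree at least `W - km`, because `∂ᵏT/∂yᵏ (P, Q) ≠ 0`. On the other hand,
`D(p, H(p, q)) = H_y(p, q) D(p, q)` and `deg D(a, b) ≤ deg a + deg b - 2` bound the effect of each
derivative on the degree, so that `deg w ≥ W - k (n + m - 2 - deg D(p, q))`.

The exponents of `Y` in `T(P, Y)` are congruent modulo `n / gcd(n, m)`, and in characteristic zero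
a polynomial with `N` terms has no nonzero root of multiplicity `N`; hence `k m n / gcd(n, m) ≤ W`.
If `n ∤ m` and `k ≠ 0`, this gives `k (n + m) ≤ 2 k m ≤ W`, so `deg w > deg D(p, q)`. If `m = c n`
and `k ≠ 0`, then `Q` is a scalar multiple of `P ^ c`, and the pair is not elementary reduced.
-/

section SparsePolynomial

variable {R : Type*}

theorem card_support_derivative_lt [Semiring R] {f : Polynomial R} (hf : f.coeff 0 ≠ 0) :
    (Polynomial.derivative f).support.card < f.support.card :=
  calc (Polynomial.derivative f).support.card
      ≤ (f.support.erase 0).card := by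
        refine Finset.card_le_card_of_injOn (· + 1) (fun j hj => ?_) (add_left_injective 1).injOn
        have hcoeff : f.coeff (j + 1) * (j + 1) ≠ 0 := by
          simpa [Polynomial.coeff_derivative] using hj
        simpa using left_ne_zero_of_mul hcoeff
    _ < f.support.card := Finset.card_erase_lt_of_mem (by simpa using hf)

theorem card_support_le_card_support_X_mul [Semiring R] (f : Polynomial R) :
    f.support.card ≤ (Polynomial.X * f).support.card :=
  Finset.card_le_card_of_injOn (· + 1) (fun j hj => by simpa using hj) (add_left_injective 1).injOn

variable [CommRing R] [IsDomain R] [CharZero R] {f : Polynomial R} {a : R}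

theorem rootMultiplicity_lt_card_support (hf : f ≠ 0) (ha : a ≠ 0) :
    f.rootMultiplicity a < f.support.card := by
  induction hN : f.natDegree using Nat.strong_induction_on generalizing f with
  | _ N ih =>
  subst hN
  by_cases hf0 : f.coeff 0 = 0
  · obtain ⟨g, rfl⟩ := Polynomial.X_dvd_iff.2 hf0
    have hg : g ≠ 0 := right_ne_zero_of_mul hf
    have hX : (Polynomial.X : Polynomial R).rootMultiplicity a = 0 :=
      Polynomial.rootMultiplicity_eq_zero (by simpa using ha)
    calc (Polynomial.X * g).rootMultiplicity a
        = g.rootMultiplicity a := by rw [Polynomial.rootMultiplicity_mul hf, hX, zero_add]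
      _ < g.support.card := ih _ (by rw [Polynomial.natDegree_X_mul hg]; omega) hg rfl
      _ ≤ (Polynomial.X * g).support.card := card_support_le_card_support_X_mul g
  by_cases hdeg : f.natDegree = 0
  · obtain ⟨c, rfl⟩ := Polynomial.natDegree_eq_zero.1 hdeg
    rw [Polynomial.rootMultiplicity_C]
    exact Finset.card_pos.2 (Polynomial.nonempty_support_iff.2 hf)
  · have hderiv : Polynomial.derivative f ≠ 0 := mt Polynomial.derivative_eq_zero.1 hdeg
    have hlt := ih _ (Polynomial.natDegree_derivative_lt hdeg) hderiv rfl
    have hdrop := Polynomial.rootMultiplicity_sub_one_le_derivative_rootMultiplicity f a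
    have hcard := card_support_derivative_lt hf0
    omega

theorem mul_rootMultiplicity_le_natDegree (hf : f ≠ 0) (ha : a ≠ 0) {e : ℕ}
    (he : ∀ i ∈ f.support, ∀ j ∈ f.support, i ≡ j [MOD e]) :
    e * f.rootMultiplicity a ≤ f.natDegree := by
  have hcard : f.support.card ≤ f.natDegree / e + 1 := by
    rw [← Finset.card_range (f.natDegree / e + 1)]
    refine Finset.card_le_card_of_injOn (· / e) (fun j hj => ?_) fun i hi j hj hij => ?_
    · simpa [Nat.lt_succ_iff] using Nat.div_le_div_right (Polynomial.le_natDegree_of_mem_supp j hj)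
    · rw [← Nat.div_add_mod i e, ← Nat.div_add_mod j e, show i % e = j % e from he i hi j hj,
        show i / e = j / e from hij]
  have hmult := rootMultiplicity_lt_card_support hf ha
  calc e * f.rootMultiplicity a ≤ e * (f.natDegree / e) := Nat.mul_le_mul_left _ (by omega)
    _ ≤ f.natDegree := Nat.mul_div_le _ _

theorem eval_iterate_derivative_rootMultiplicity_ne_zero (hf : f ≠ 0) :
    (Polynomial.derivative^[f.rootMultiplicity a] f).eval a ≠ 0 := by
  rw [Polynomial.eval_iterate_derivative_rootMultiplicity]
  exact smul_ne_zero (Nat.factorial_ne_zero _)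
    (Polynomial.eval_divByMonic_pow_rootMultiplicity_ne_zero a hf)

end SparsePolynomial

section LeadingForm

variable {σ τ ι R : Type*} [CommSemiring R]

/-- The leading form of `f` for the grading in which `X i` has weight `w i`: the sum of the terms
of maximal weight. The weight `1` gives the homogeneous component of top total degree. -/
noncomputable def leadingForm (w : σ → ℕ) (f : MvPolynomial σ R) : MvPolynomial σ R :=
  weightedHomogeneousComponent w (weightedTotalDegree w f) f

theorem isWeightedHomogeneous_leadingForm (w : σ → ℕ) (f : MvPolynomial σ R) :
    IsWeightedHomogeneous w (leadingForm w f) (weightedTotalDegree w f) :=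
  weightedHomogeneousComponent_isWeightedHomogeneous _ _

theorem isHomogeneous_leadingForm_one (f : MvPolynomial σ R) :
    (leadingForm 1 f).IsHomogeneous f.totalDegree := by
  rw [← weightedTotalDegree_one]
  exact isWeightedHomogeneous_leadingForm 1 f

theorem leadingForm_ne_zero (w : σ → ℕ) {f : MvPolynomial σ R} (hf : f ≠ 0) :
    leadingForm w f ≠ 0 := by
  obtain ⟨d, hd, hdeg⟩ := Finset.exists_mem_eq_sup f.support (support_nonempty.2 hf)
    (Finsupp.weight w)
  refine ne_zero_iff.2 ⟨d, ?_⟩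
  rw [leadingForm, coeff_weightedHomogeneousComponent,
    if_pos (show _ = weightedTotalDegree w f from hdeg.symm)]
  exact mem_support_iff.1 hd

theorem le_weightedTotalDegree_of_weightedHomogeneousComponent_ne_zero {w : σ → ℕ}
    {f : MvPolynomial σ R} {a : ℕ} (h : weightedHomogeneousComponent w a f ≠ 0) :
    a ≤ weightedTotalDegree w f :=
  not_lt.1 (mt (weightedHomogeneousComponent_eq_zero a f) h)

theorem weightedTotalDegree_mul_le (w : σ → ℕ) (f g : MvPolynomial σ R) :
    weightedTotalDegree w (f * g) ≤ weightedTotalDegree w f + weightedTotalDegree w g := by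
  classical
  refine Finset.sup_le fun d hd => ?_
  obtain ⟨a, ha, b, hb, rfl⟩ := Finset.mem_add.1 (support_mul f g hd)
  rw [map_add]
  exact add_le_add (le_weightedTotalDegree w ha) (le_weightedTotalDegree w hb)

theorem weightedHomogeneousComponent_mul_of_le {w : σ → ℕ} {f g : MvPolynomial σ R} {a b : ℕ}
    (hf : weightedTotalDegree w f ≤ a) (hg : weightedTotalDegree w g ≤ b) :
    weightedHomogeneousComponent w (a + b) (f * g) =
      weightedHomogeneousComponent w a f * weightedHomogeneousComponent w b g := by
  classical
  ext d
  rw [coeff_weightedHomogeneousComponent]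
  split_ifs with hd
  · rw [coeff_mul, coeff_mul]
    refine Finset.sum_congr rfl fun x hx => ?_
    have hweight : Finsupp.weight w x.1 + Finsupp.weight w x.2 = a + b := by
      rw [← map_add, Finset.HasAntidiagonal.mem_antidiagonal.1 hx, hd]
    rw [coeff_weightedHomogeneousComponent, coeff_weightedHomogeneousComponent]
    by_cases hfx : x.1 ∈ f.support
    · by_cases hgx : x.2 ∈ g.support
      · have ha := (le_weightedTotalDegree w hfx).trans hf
        have hb := (le_weightedTotalDegree w hgx).trans hg
        rw [if_pos (by omega), if_pos (by omega)]
      · simp [notMem_support_iff.1 hgx]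
    · simp [notMem_support_iff.1 hfx]
  · exact (((weightedHomogeneousComponent_isWeightedHomogeneous a f).mul
      (weightedHomogeneousComponent_isWeightedHomogeneous b g)).coeff_eq_zero d hd).symm

section Prod

variable {w : σ → ℕ} {s : Finset ι} {f : ι → MvPolynomial σ R} {a : ι → ℕ}

theorem weightedTotalDegree_prod_le (h : ∀ i ∈ s, weightedTotalDegree w (f i) ≤ a i) :
    weightedTotalDegree w (∏ i ∈ s, f i) ≤ ∑ i ∈ s, a i := by
  classical
  induction s using Finset.induction_on with
  | empty =>
    simpa using isWeightedHomogeneous_zero_iff_weightedTotalDegree_eq_zero.1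
      (isWeightedHomogeneous_one R w)
  | insert i s hi ih =>
    rw [Finset.forall_mem_insert] at h
    rw [Finset.prod_insert hi, Finset.sum_insert hi]
    exact (weightedTotalDegree_mul_le w _ _).trans (add_le_add h.1 (ih h.2))

theorem weightedHomogeneousComponent_prod_of_le
    (h : ∀ i ∈ s, weightedTotalDegree w (f i) ≤ a i) :
    weightedHomogeneousComponent w (∑ i ∈ s, a i) (∏ i ∈ s, f i) =
      ∏ i ∈ s, weightedHomogeneousComponent w (a i) (f i) := by
  classical
  induction s using Finset.induction_on with
  | empty =>
    simpa using (isWeightedHomogeneous_one R w).weightedHomogeneousComponent_same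
  | insert i s hi ih =>
    rw [Finset.forall_mem_insert] at h
    rw [Finset.prod_insert hi, Finset.prod_insert hi, Finset.sum_insert hi, ← ih h.2,
      weightedHomogeneousComponent_mul_of_le h.1 (weightedTotalDegree_prod_le h.2)]

end Prod

theorem weightedTotalDegree_pow_le {w : σ → ℕ} {f : MvPolynomial σ R} {a : ℕ}
    (hf : weightedTotalDegree w f ≤ a) (j : ℕ) : weightedTotalDegree w (f ^ j) ≤ j * a := by
  simpa using weightedTotalDegree_prod_le (s := Finset.range j) (f := fun _ => f) fun _ _ => hf

theorem weightedHomogeneousComponent_pow_of_le {w : σ → ℕ} {f : MvPolynomial σ R} {a : ℕ}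
    (hf : weightedTotalDegree w f ≤ a) (j : ℕ) :
    weightedHomogeneousComponent w (j * a) (f ^ j) = weightedHomogeneousComponent w a f ^ j := by
  simpa using
    weightedHomogeneousComponent_prod_of_le (s := Finset.range j) (f := fun _ => f) fun _ _ => hf

theorem weightedHomogeneousComponent_aeval {v : σ → ℕ} {w : τ → ℕ} {p : τ → MvPolynomial σ R}
    (hp : ∀ i, weightedTotalDegree v (p i) ≤ w i) {G : MvPolynomial τ R} {W : ℕ}
    (hG : weightedTotalDegree w G ≤ W) :
    weightedHomogeneousComponent v W (aeval p G) =
      aeval (fun i => weightedHomogeneousComponent v (w i) (p i))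
        (weightedHomogeneousComponent w W G) := by
  classical
  rw [weightedHomogeneousComponent_apply W G, map_sum, Finset.sum_filter, aeval_def, eval₂_eq,
    map_sum]
  refine Finset.sum_congr rfl fun d hd => ?_
  have hpow : ∀ i ∈ d.support, weightedTotalDegree v (p i ^ d i) ≤ d i * w i :=
    fun i _ => weightedTotalDegree_pow_le (hp i) _
  have hweight : Finsupp.weight w d = ∑ i ∈ d.support, d i * w i := Finsupp.weight_apply w d
  rw [algebraMap_eq, weightedHomogeneousComponent_C_mul]
  split_ifs with hdW
  · rw [← hdW, hweight, weightedHomogeneousComponent_prod_of_le hpow, aeval_monomial]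
    simp only [weightedHomogeneousComponent_pow_of_le (hp _), algebraMap_eq, Finsupp.prod]
  · have hlt : weightedTotalDegree v (∏ i ∈ d.support, p i ^ d i) < W :=
      (weightedTotalDegree_prod_le hpow).trans_lt
        (hweight ▸ lt_of_le_of_ne ((le_weightedTotalDegree w hd).trans hG) hdW)
    rw [weightedHomogeneousComponent_eq_zero _ _ hlt, mul_zero]

theorem weightedTotalDegree_iterate_pderiv_le (w : σ → ℕ) (i : σ) (k : ℕ) (f : MvPolynomial σ R) :
    weightedTotalDegree w ((pderiv i)^[k] f) ≤ weightedTotalDegree w f - k * w i := by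
  classical
  induction k with
  | zero => simp
  | succ k ih =>
    rw [Function.iterate_succ_apply']
    refine Finset.sup_le fun d hd => ?_
    rw [mem_support_iff, coeff_pderiv] at hd
    have hle := le_weightedTotalDegree w (mem_support_iff.2 (left_ne_zero_of_mul hd))
    rw [map_add, Finsupp.weight_single, one_smul] at hle
    rw [add_mul, one_mul]
    omega

theorem weightedHomogeneousComponent_iterate_pderiv (w : σ → ℕ) (i : σ) (V k : ℕ)
    (f : MvPolynomial σ R) :
    weightedHomogeneousComponent w V ((pderiv i)^[k] f) =
      (pderiv i)^[k] (weightedHomogeneousComponent w (V + k * w i) f) := by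
  classical
  induction k generalizing V with
  | zero => simp
  | succ k ih =>
    rw [Function.iterate_succ_apply', Function.iterate_succ_apply', add_mul, one_mul,
      add_comm (k * w i), ← add_assoc, ← ih]
    ext d
    simp [coeff_weightedHomogeneousComponent, coeff_pderiv, Finsupp.weight_single]

theorem weightedHomogeneousComponent_aeval_iterate_pderiv {v : σ → ℕ} {w : τ → ℕ}
    {p : τ → MvPolynomial σ R} (hp : ∀ i, weightedTotalDegree v (p i) = w i)
    {G : MvPolynomial τ R} {i : τ} {V k : ℕ}
    (hV : V + k * w i = weightedTotalDegree w G) :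
    weightedHomogeneousComponent v V (aeval p ((pderiv i)^[k] G)) =
      aeval (fun j => leadingForm v (p j)) ((pderiv i)^[k] (leadingForm w G)) := by
  have hG : weightedTotalDegree w ((pderiv i)^[k] G) ≤ V := by
    have := weightedTotalDegree_iterate_pderiv_le w i k G
    omega
  rw [weightedHomogeneousComponent_aeval (fun j => (hp j).le) hG,
    weightedHomogeneousComponent_iterate_pderiv, hV]
  simp only [leadingForm, hp]

end LeadingForm

section PartialEval

variable {R A : Type*} [CommSemiring R] [CommSemiring A] [Algebra R A]

/-- The univariate polynomial `G(u, Y)` attached to a polynomial `G` in two variables; evaluating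
only the first variable turns vanishing of `G` at `(u, v)` into a root `v` with a multiplicity. -/
noncomputable def partialEval (u : A) : MvPolynomial (Fin 2) R →ₐ[R] Polynomial A :=
  aeval ![Polynomial.C u, Polynomial.X]

theorem aeval_partialEval {B : Type*} [CommSemiring B] [Algebra A B] [Algebra R B]
    [IsScalarTower R A B] (u : A) (v : B) (G : MvPolynomial (Fin 2) R) :
    Polynomial.aeval v (partialEval u G) = aeval ![algebraMap A B u, v] G := by
  change ((Polynomial.aeval v).restrictScalars R).comp (partialEval u) G = _
  congr 1
  ext i
  fin_cases i <;> simp [partialEval]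

theorem derivative_partialEval (u : A) (G : MvPolynomial (Fin 2) R) :
    Polynomial.derivative (partialEval u G) = partialEval u (pderiv 1 G) := by
  induction G using MvPolynomial.induction_on with
  | C a => simp [partialEval, Polynomial.algebraMap_apply]
  | add f g hf hg => simp only [map_add, hf, hg]
  | mul_X f i hf =>
    rw [map_mul, Polynomial.derivative_mul, hf]
    fin_cases i <;> simp [partialEval, mul_comm, add_comm]

theorem iterate_derivative_partialEval (u : A) (k : ℕ) (G : MvPolynomial (Fin 2) R) :
    Polynomial.derivative^[k] (partialEval u G) = partialEval u ((pderiv 1)^[k] G) :=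
  (Function.Semiconj.iterate_right (fun G => (derivative_partialEval u G).symm) k G).symm

theorem coeff_partialEval (u : A) (G : MvPolynomial (Fin 2) R) (j : ℕ) :
    (partialEval u G).coeff j =
      ∑ d ∈ G.support with d 1 = j, algebraMap R A (coeff d G) * u ^ d 0 := by
  rw [partialEval, aeval_def, eval₂_eq', Polynomial.finsetSum_coeff, Finset.sum_filter]
  refine Finset.sum_congr rfl fun d _ => ?_
  simp only [Fin.prod_univ_two, Matrix.cons_val_zero, Matrix.cons_val_one,
    Polynomial.algebraMap_apply]
  rw [← mul_assoc, ← Polynomial.C_pow, ← Polynomial.C_mul, Polynomial.coeff_C_mul,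
    Polynomial.coeff_X_pow]
  simp [eq_comm]

theorem exists_mem_support_of_mem_support_partialEval {u : A} {G : MvPolynomial (Fin 2) R} {j : ℕ}
    (hj : j ∈ (partialEval u G).support) : ∃ d ∈ G.support, d 1 = j := by
  rw [Polynomial.mem_support_iff, coeff_partialEval] at hj
  obtain ⟨d, hd, -⟩ := Finset.exists_ne_zero_of_sum_ne_zero hj
  exact ⟨d, Finset.mem_filter.1 hd⟩

end PartialEval

section WeightedHomogeneous

variable {R : Type*} [CommSemiring R] {n m W : ℕ} {G : MvPolynomial (Fin 2) R}

theorem weight_fin_two (n m : ℕ) (d : Fin 2 →₀ ℕ) :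
    Finsupp.weight ![n, m] d = d 0 * n + d 1 * m := by
  simp [Finsupp.weight_eq_sum]

theorem partialEval_ne_zero {A : Type*} [CommSemiring A] [NoZeroDivisors A] [Algebra R A]
    [FaithfulSMul R A] {u : A} (hu : u ≠ 0) (hn : 0 < n) (hG : G ≠ 0)
    (hGW : IsWeightedHomogeneous ![n, m] G W) : partialEval u G ≠ 0 := by
  obtain ⟨d, hd⟩ := support_nonempty.2 hG
  have hunique : ∀ d' ∈ G.support, d' 1 = d 1 → d' = d := by
    intro d' hd' h1
    have hweight := (hGW (mem_support_iff.1 hd')).trans (hGW (mem_support_iff.1 hd)).symm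
    rw [weight_fin_two, weight_fin_two, h1] at hweight
    have h0 : d' 0 = d 0 := Nat.eq_of_mul_eq_mul_right hn (Nat.add_right_cancel hweight)
    ext i
    fin_cases i
    exacts [h0, h1]
  have hcoeff : (partialEval u G).coeff (d 1) = algebraMap R A (coeff d G) * u ^ d 0 := by
    rw [coeff_partialEval, Finset.sum_eq_single_of_mem d (by simpa using hd)]
    intro d' hd' hne
    rw [Finset.mem_filter] at hd'
    exact absurd (hunique d' hd'.1 hd'.2) hne
  intro hzero
  rw [hzero, Polynomial.coeff_zero, zero_eq_mul] at hcoeff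
  rcases hcoeff with hcoeff | hpow
  · exact mem_support_iff.1 hd (by simpa using hcoeff)
  · exact hu (eq_zero_of_pow_eq_zero hpow)

theorem mul_rootMultiplicity_partialEval_le {A : Type*} [CommRing A] [IsDomain A] [CharZero A]
    [Algebra R A] [FaithfulSMul R A] {u v : A} (hu : u ≠ 0) (hv : v ≠ 0) (hn : 0 < n)
    (hG : G ≠ 0) (hGW : IsWeightedHomogeneous ![n, m] G W) :
    n / n.gcd m * (partialEval u G).rootMultiplicity v * m ≤ W := by
  have hne := partialEval_ne_zero hu hn hG hGW
  have hweight : ∀ j ∈ (partialEval u G).support, ∃ i, i * n + j * m = W := by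
    intro j hj
    obtain ⟨d, hd, rfl⟩ := exists_mem_support_of_mem_support_partialEval hj
    exact ⟨d 0, by rw [← weight_fin_two]; exact hGW (mem_support_iff.1 hd)⟩
  have hmod : ∀ j ∈ (partialEval u G).support, m * j ≡ W [MOD n] := by
    intro j hj
    obtain ⟨i, rfl⟩ := hweight j hj
    simp [Nat.ModEq, mul_comm j m]
  have hdegree := mul_rootMultiplicity_le_natDegree hne hv fun i hi j hj =>
    Nat.ModEq.cancel_left_div_gcd hn ((hmod i hi).trans (hmod j hj).symm)
  obtain ⟨i, hi⟩ := hweight _ (Polynomial.natDegree_mem_support_of_nonzero hne)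
  calc n / n.gcd m * (partialEval u G).rootMultiplicity v * m
      ≤ (partialEval u G).natDegree * m := Nat.mul_le_mul_right m hdegree
    _ ≤ W := by omega

theorem aeval_pow_mul_of_isWeightedHomogeneous {σ A : Type*} [CommSemiring A] [Algebra R A]
    {w : σ → ℕ} {f : MvPolynomial σ R} {W : ℕ} (hf : IsWeightedHomogeneous w f W) (t : A)
    (x : σ → A) : aeval (fun i => t ^ w i * x i) f = t ^ W * aeval x f := by
  rw [aeval_def, aeval_def, eval₂_eq, eval₂_eq, Finset.mul_sum]
  refine Finset.sum_congr rfl fun d hd => ?_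
  have hpow : ∏ i ∈ d.support, (t ^ w i) ^ d i = t ^ W := by
    simp_rw [← hf (mem_support_iff.1 hd), Finsupp.weight_apply, Finsupp.sum, ← pow_mul,
      Finset.prod_pow_eq_pow_sum, smul_eq_mul, mul_comm]
  simp_rw [mul_pow, Finset.prod_mul_distrib, hpow]
  ring

theorem isWeightedHomogeneous_of_smul {σ : Type*} {w : σ → ℕ} {f : MvPolynomial σ R} {c W : ℕ}
    (hc : 0 < c) (hf : IsWeightedHomogeneous (c • w) f W) : IsWeightedHomogeneous w f (W / c) := by
  intro d hd
  refine (Nat.div_eq_of_eq_mul_right hc ?_).symm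
  rw [← hf hd]
  simp [Finsupp.weight_apply, Finsupp.sum, Finset.mul_sum, mul_left_comm]

end WeightedHomogeneous

section IntegrallyClosed

variable {K A : Type*} [Field K] [CommRing A] [IsDomain A] [IsIntegrallyClosed A] [Algebra K A]
  {c W : ℕ} {G : MvPolynomial (Fin 2) K} {P Q : A}

-- `Q / P ^ c` is a root of `G(1, Y)`, hence integral over the field `K`.
theorem pow_dvd_of_aeval_eq_zero (hP : P ≠ 0) (hG : G ≠ 0)
    (hGW : IsWeightedHomogeneous ![1, c] G W) (hzero : aeval ![P, Q] G = 0) : P ^ c ∣ Q := by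
  let F := FractionRing A
  have hinj : Function.Injective (algebraMap A F) := IsFractionRing.injective A F
  set x : F := algebraMap A F P
  set z : F := algebraMap A F Q / x ^ c
  have hx : x ≠ 0 := (map_ne_zero_iff _ hinj).2 hP
  have hz : x ^ c * z = algebraMap A F Q := mul_div_cancel₀ _ (pow_ne_zero c hx)
  have hroot : Polynomial.aeval z (partialEval (1 : K) G) = 0 := by
    have hscale := aeval_pow_mul_of_isWeightedHomogeneous hGW x ![1, z]
    have hpoint : (fun i => x ^ ![1, c] i * ![1, z] i) = algebraMap A F ∘ ![P, Q] := by
      ext i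
      fin_cases i <;> simp [x, hz]
    rw [hpoint, aeval_algebraMap_apply, hzero, map_zero, zero_eq_mul] at hscale
    rw [aeval_partialEval, map_one]
    exact hscale.resolve_left (pow_ne_zero W hx)
  have hintegral : IsIntegral A z :=
    (IsAlgebraic.isIntegral
      ⟨_, partialEval_ne_zero one_ne_zero one_pos hG hGW, hroot⟩ : IsIntegral K z).tower_top
  obtain ⟨y, hy⟩ := IsIntegrallyClosed.isIntegral_iff.1 hintegral
  exact ⟨y, hinj (by rw [map_mul, map_pow, hy, hz])⟩

end IntegrallyClosed

section JacobianDet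

variable {K : Type*} [Field K] {p q G : MvPolynomial (Fin 2) K}

theorem jacobianDet_eq (p q : MvPolynomial (Fin 2) K) :
    jacobianDet p q = pderiv 0 p * pderiv 1 q - pderiv 1 p * pderiv 0 q := by
  simp [jacobianDet, Matrix.det_fin_two]

theorem jacobianDet_swap (p q : MvPolynomial (Fin 2) K) :
    jacobianDet q p = -jacobianDet p q := by
  rw [jacobianDet_eq, jacobianDet_eq]
  ring

theorem totalDegree_left_pos_of_jacobianDet_ne_zero (h : jacobianDet p q ≠ 0) :
    0 < p.totalDegree := by
  refine Nat.pos_of_ne_zero (mt (fun hp => ?_) h)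
  rw [totalDegree_eq_zero_iff_eq_C.1 hp]
  simp [jacobianDet_eq]

theorem totalDegree_right_pos_of_jacobianDet_ne_zero (h : jacobianDet p q ≠ 0) :
    0 < q.totalDegree :=
  totalDegree_left_pos_of_jacobianDet_ne_zero (q := p) (by rwa [jacobianDet_swap, neg_ne_zero])

theorem pderiv_aeval {σ τ R : Type*} [Fintype τ] [CommSemiring R] (p : τ → MvPolynomial σ R)
    (G : MvPolynomial τ R) (i : σ) :
    pderiv i (aeval p G) = ∑ j, aeval p (pderiv j G) * pderiv i (p j) := by
  classical
  induction G using MvPolynomial.induction_on with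
  | C a => simp [algebraMap_eq]
  | add f g hf hg => simp only [map_add, hf, hg, add_mul, Finset.sum_add_distrib]
  | mul_X f k hf =>
    simp [-aeval_eq_bind₁, hf, pderiv_X, Pi.single_apply, apply_ite (aeval p), add_mul, mul_assoc,
      Finset.sum_add_distrib, Finset.mul_sum]

theorem jacobianDet_aeval (p q G : MvPolynomial (Fin 2) K) :
    jacobianDet p (aeval ![p, q] G) = aeval ![p, q] (pderiv 1 G) * jacobianDet p q := by
  simp only [jacobianDet_eq, pderiv_aeval, Fin.sum_univ_two, Matrix.cons_val_zero,
    Matrix.cons_val_one, Matrix.cons_val_fin_one]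
  ring

theorem totalDegree_pderiv_le {σ R : Type*} [CommSemiring R] (i : σ) (f : MvPolynomial σ R) :
    (pderiv i f).totalDegree ≤ f.totalDegree - 1 := by
  simpa [weightedTotalDegree_one] using weightedTotalDegree_iterate_pderiv_le 1 i 1 f

theorem totalDegree_jacobianDet_add_two_le (h : jacobianDet p q ≠ 0) :
    (jacobianDet p q).totalDegree + 2 ≤ p.totalDegree + q.totalDegree := by
  have hp := totalDegree_left_pos_of_jacobianDet_ne_zero h
  have hq := totalDegree_right_pos_of_jacobianDet_ne_zero h
  have hmul (i j : Fin 2) :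
      (pderiv i p * pderiv j q).totalDegree ≤ (p.totalDegree - 1) + (q.totalDegree - 1) :=
    (totalDegree_mul _ _).trans
      (add_le_add (totalDegree_pderiv_le i p) (totalDegree_pderiv_le j q))
  have hsub := (totalDegree_sub (pderiv 0 p * pderiv 1 q) (pderiv 1 p * pderiv 0 q)).trans
    (max_le (hmul 0 1) (hmul 1 0))
  rw [← jacobianDet_eq] at hsub
  omega

theorem totalDegree_aeval_pderiv_add_le (hD : jacobianDet p q ≠ 0)
    (hG : aeval ![p, q] (pderiv 1 G) ≠ 0) :
    (aeval ![p, q] (pderiv 1 G)).totalDegree + ((jacobianDet p q).totalDegree + 2) ≤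
      (aeval ![p, q] G).totalDegree + p.totalDegree := by
  have hle := totalDegree_jacobianDet_add_two_le (p := p) (q := aeval ![p, q] G)
    (by rw [jacobianDet_aeval]; exact mul_ne_zero hG hD)
  rw [jacobianDet_aeval, totalDegree_mul_of_isDomain hG hD] at hle
  omega

theorem totalDegree_aeval_iterate_pderiv_add_le (hD : jacobianDet p q ≠ 0) {k : ℕ}
    (hG : aeval ![p, q] ((pderiv 1)^[k] G) ≠ 0) :
    (aeval ![p, q] ((pderiv 1)^[k] G)).totalDegree + k * ((jacobianDet p q).totalDegree + 2) ≤
      (aeval ![p, q] G).totalDegree + k * p.totalDegree := by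
  induction k with
  | zero => simp
  | succ k ih =>
    rw [Function.iterate_succ_apply'] at hG ⊢
    have hprev : aeval ![p, q] ((pderiv 1)^[k] G) ≠ 0 := by
      intro hzero
      refine mul_ne_zero hG hD ?_
      rw [← jacobianDet_aeval, hzero]
      simp [jacobianDet_eq]
    have hstep := totalDegree_aeval_pderiv_add_le hD hG
    have hle := ih hprev
    rw [add_mul, add_mul, one_mul, one_mul]
    omega

end JacobianDet

section LeadingMultiplicity

/-- The multiplicity of the leading form of `q` as a root of `T(P, Y)`, where `P` is the leading
form of `p` and `T` is the leading form of `G` for the weights `deg p`, `deg q`. It measures how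
far the degree of `G(p, q)` can drop below the weighted degree of `G`. -/
noncomputable def leadingMultiplicity {σ R : Type*} [CommRing R] (p q : MvPolynomial σ R)
    (G : MvPolynomial (Fin 2) R) : ℕ :=
  (partialEval (leadingForm 1 p)
    (leadingForm ![p.totalDegree, q.totalDegree] G)).rootMultiplicity (leadingForm 1 q)

theorem ne_zero_of_totalDegree_pos {σ R : Type*} [CommSemiring R] {f : MvPolynomial σ R}
    (hf : 0 < f.totalDegree) : f ≠ 0 := by
  rintro rfl
  simp at hf

theorem aeval_leadingForm_eq_zero {σ R : Type*} [CommRing R] {p q : MvPolynomial σ R}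
    {G : MvPolynomial (Fin 2) R} (hk : leadingMultiplicity p q G ≠ 0) :
    aeval ![leadingForm 1 p, leadingForm 1 q]
      (leadingForm ![p.totalDegree, q.totalDegree] G) = 0 := by
  have hroot := not_imp_comm.1 Polynomial.rootMultiplicity_eq_zero hk
  rwa [Polynomial.IsRoot, ← Polynomial.coe_aeval_eq_eval, aeval_partialEval] at hroot

section Domain

variable {σ R : Type*} [CommRing R] [IsDomain R] {p q : MvPolynomial σ R}
  {G : MvPolynomial (Fin 2) R}

theorem partialEval_leadingForm_ne_zero (hp : 0 < p.totalDegree) (hG : G ≠ 0) :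
    partialEval (leadingForm 1 p) (leadingForm ![p.totalDegree, q.totalDegree] G) ≠ 0 :=
  partialEval_ne_zero (leadingForm_ne_zero 1 (ne_zero_of_totalDegree_pos hp)) hp
    (leadingForm_ne_zero _ hG) (isWeightedHomogeneous_leadingForm _ G)

theorem mul_leadingMultiplicity_mul_le [CharZero R] (hp : 0 < p.totalDegree) (hq : q ≠ 0)
    (hG : G ≠ 0) :
    p.totalDegree / p.totalDegree.gcd q.totalDegree * leadingMultiplicity p q G * q.totalDegree ≤
      weightedTotalDegree ![p.totalDegree, q.totalDegree] G :=
  mul_rootMultiplicity_partialEval_le (leadingForm_ne_zero 1 (ne_zero_of_totalDegree_pos hp))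
    (leadingForm_ne_zero 1 hq) hp (leadingForm_ne_zero _ hG)
    (isWeightedHomogeneous_leadingForm _ G)

theorem leadingMultiplicity_mul_le [CharZero R] (hp : 0 < p.totalDegree) (hq : q ≠ 0)
    (hG : G ≠ 0) :
    leadingMultiplicity p q G * q.totalDegree ≤
      weightedTotalDegree ![p.totalDegree, q.totalDegree] G := by
  refine le_trans (Nat.mul_le_mul_right _ (Nat.le_mul_of_pos_left _ ?_))
    (mul_leadingMultiplicity_mul_le hp hq hG)
  exact Nat.div_pos (Nat.gcd_le_left _ hp) (Nat.gcd_pos_of_pos_left _ hp)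

theorem aeval_iterate_pderiv_leadingForm_ne_zero [CharZero R] (hp : 0 < p.totalDegree)
    (hG : G ≠ 0) :
    aeval ![leadingForm 1 p, leadingForm 1 q]
      ((pderiv 1)^[leadingMultiplicity p q G]
        (leadingForm ![p.totalDegree, q.totalDegree] G)) ≠ 0 := by
  have hne := eval_iterate_derivative_rootMultiplicity_ne_zero (a := leadingForm 1 q)
    (partialEval_leadingForm_ne_zero (q := q) hp hG)
  rwa [iterate_derivative_partialEval, ← Polynomial.coe_aeval_eq_eval, aeval_partialEval] at hne

end Domain

variable {K : Type*} [Field K]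

theorem leadingForm_pow_dvd_leadingForm {σ : Type*} {p q : MvPolynomial σ K}
    {G : MvPolynomial (Fin 2) K} (hp : 0 < p.totalDegree) (hG : G ≠ 0) {c : ℕ}
    (hc : q.totalDegree = p.totalDegree * c) (hk : leadingMultiplicity p q G ≠ 0) :
    leadingForm 1 p ^ c ∣ leadingForm 1 q := by
  have hweights : ![p.totalDegree, q.totalDegree] = p.totalDegree • ![1, c] := by simp [hc]
  have hzero := aeval_leadingForm_eq_zero hk
  have hhom := isWeightedHomogeneous_leadingForm ![p.totalDegree, q.totalDegree] G
  rw [hweights] at hzero hhom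
  exact pow_dvd_of_aeval_eq_zero (leadingForm_ne_zero 1 (ne_zero_of_totalDegree_pos hp))
    (leadingForm_ne_zero _ hG) (isWeightedHomogeneous_of_smul hp hhom) hzero

variable [CharZero K] {p q G : MvPolynomial (Fin 2) K}

theorem weightedTotalDegree_add_leadingMultiplicity_mul_le (hD : jacobianDet p q ≠ 0)
    (hG : G ≠ 0) :
    weightedTotalDegree ![p.totalDegree, q.totalDegree] G +
        leadingMultiplicity p q G * ((jacobianDet p q).totalDegree + 2) ≤
      (aeval ![p, q] G).totalDegree +
        leadingMultiplicity p q G * (p.totalDegree + q.totalDegree) := by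
  have hp : 0 < p.totalDegree := totalDegree_left_pos_of_jacobianDet_ne_zero hD
  have hq : q ≠ 0 := ne_zero_of_totalDegree_pos (totalDegree_right_pos_of_jacobianDet_ne_zero hD)
  obtain ⟨V, hV⟩ := Nat.exists_eq_add_of_le' (leadingMultiplicity_mul_le hp hq hG)
  have hdeg (i : Fin 2) :
      weightedTotalDegree 1 (![p, q] i) = ![p.totalDegree, q.totalDegree] i := by
    fin_cases i <;> simp [weightedTotalDegree_one]
  have hforms : (fun i => leadingForm 1 (![p, q] i)) = ![leadingForm 1 p, leadingForm 1 q] := by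
    ext1 i
    fin_cases i <;> rfl
  have hcomponent := weightedHomogeneousComponent_aeval_iterate_pderiv hdeg (i := 1) hV.symm
  have hne : weightedHomogeneousComponent 1 V
      (aeval ![p, q] ((pderiv 1)^[leadingMultiplicity p q G] G)) ≠ 0 := by
    rw [hcomponent, hforms]
    exact aeval_iterate_pderiv_leadingForm_ne_zero hp hG
  have hVle : V ≤ (aeval ![p, q] ((pderiv 1)^[leadingMultiplicity p q G] G)).totalDegree := by
    rw [← weightedTotalDegree_one]
    exact le_weightedTotalDegree_of_weightedHomogeneousComponent_ne_zero hne
  have hderiv := totalDegree_aeval_iterate_pderiv_add_le hD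
    fun hzero => hne (by rw [hzero, map_zero])
  rw [hV, mul_add _ p.totalDegree]
  omega

theorem totalDegree_jacobianDet_lt_totalDegree_aeval (hpq : p.totalDegree ≤ q.totalDegree)
    (hdvd : ¬ p.totalDegree ∣ q.totalDegree) (hD : jacobianDet p q ≠ 0) (hG : G ≠ 0)
    (hk : leadingMultiplicity p q G ≠ 0) :
    (jacobianDet p q).totalDegree < (aeval ![p, q] G).totalDegree := by
  have hp : 0 < p.totalDegree := totalDegree_left_pos_of_jacobianDet_ne_zero hD
  have hq : q ≠ 0 := ne_zero_of_totalDegree_pos (totalDegree_right_pos_of_jacobianDet_ne_zero hD)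
  have hestimate := weightedTotalDegree_add_leadingMultiplicity_mul_le hD hG
  have hsparse := mul_leadingMultiplicity_mul_le hp hq hG
  generalize p.totalDegree = n, q.totalDegree = m, leadingMultiplicity p q G = k at *
  have htwo : 2 ≤ n / n.gcd m := by
    refine (Nat.lt_div_iff_mul_lt' (Nat.gcd_dvd_left n m) 1).2 ?_
    rw [mul_one]
    exact lt_of_le_of_ne (Nat.gcd_le_left m hp) (mt Nat.gcd_eq_left_iff_dvd.1 hdvd)
  have hbound : k * (n + m) ≤ weightedTotalDegree ![n, m] G :=
    calc k * (n + m) ≤ k * (2 * m) := Nat.mul_le_mul_left k (by omega)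
      _ = 2 * k * m := by ring
      _ ≤ n / n.gcd m * k * m := by gcongr
      _ ≤ weightedTotalDegree ![n, m] G := hsparse
  have hone : (jacobianDet p q).totalDegree + 2 ≤ k * ((jacobianDet p q).totalDegree + 2) :=
    Nat.le_mul_of_pos_left _ (Nat.pos_of_ne_zero hk)
  omega

end LeadingMultiplicity

section Affine

variable {σ R : Type*} [CommSemiring R]

theorem exists_eq_sum_smul_X_add_C_of_totalDegree_le_one [Fintype σ]
    {G : MvPolynomial σ R} (hG : G.totalDegree ≤ 1) :
    ∃ (a : σ → R) (c : R), G = ∑ i, a i • X i + C c := by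
  classical
  have hlinear : homogeneousComponent 1 G ∈ Submodule.span R (Set.range X) := by
    rw [← homogeneousSubmodule_one_eq_span_X]
    exact homogeneousComponent_mem 1 G
  obtain ⟨a, ha⟩ := (Submodule.mem_span_range_iff_exists_fun R).1 hlinear
  refine ⟨a, coeff 0 G, ?_⟩
  rw [ha, ← homogeneousComponent_zero]
  conv_lhs => rw [← sum_homogeneousComponent G]
  obtain hdeg | hdeg : G.totalDegree = 0 ∨ G.totalDegree = 1 := by omega
  · simp [hdeg, homogeneousComponent_eq_zero 1 G (by omega)]
  · rw [hdeg, Finset.sum_range_succ', Finset.sum_range_one]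

theorem mul_totalDegree_le_weightedTotalDegree {w : σ → ℕ} {n : ℕ} (hw : ∀ i, n ≤ w i)
    (G : MvPolynomial σ R) : n * G.totalDegree ≤ weightedTotalDegree w G := by
  rcases eq_or_ne G 0 with rfl | hG
  · simp
  obtain ⟨d, hd, hdeg⟩ := Finset.exists_mem_eq_sup G.support (support_nonempty.2 hG)
    fun d => d.sum fun _ e => e
  calc n * G.totalDegree = ∑ i ∈ d.support, d i * n := by
        rw [totalDegree, hdeg, Finsupp.sum, mul_comm, Finset.sum_mul]
    _ ≤ ∑ i ∈ d.support, d i * w i := Finset.sum_le_sum fun i _ => Nat.mul_le_mul_left _ (hw i)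
    _ = Finsupp.weight w d := (Finsupp.weight_apply w d).symm
    _ ≤ weightedTotalDegree w G := le_weightedTotalDegree w hd

theorem exists_aeval_eq_affine_of_weightedTotalDegree_lt {A : Type*} [CommSemiring A] [Algebra R A]
    {n m : ℕ} (hnm : n ≤ m) {G : MvPolynomial (Fin 2) R}
    (hG : weightedTotalDegree ![n, m] G < 2 * n) (x y : A) :
    ∃ a b c : R, aeval ![x, y] G = a • x + b • y + algebraMap R A c := by
  have hle := mul_totalDegree_le_weightedTotalDegree (w := ![n, m])
    (Fin.forall_fin_two.2 ⟨le_rfl, hnm⟩) G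
  have hdeg : G.totalDegree ≤ 1 := by
    rw [mul_comm 2 n] at hG
    exact Nat.le_of_lt_succ (Nat.lt_of_mul_lt_mul_left (hle.trans_lt hG))
  obtain ⟨a, c, rfl⟩ := exists_eq_sum_smul_X_add_C_of_totalDegree_le_one hdeg
  exact ⟨a 0, a 1, c, by simp⟩

end Affine

section ElementaryReduced

variable {K : Type*} [Field K] {p q : MvPolynomial (Fin 2) K}

theorem IsElementaryReduced.symm (hred : IsElementaryReduced p q) : IsElementaryReduced q p := by
  intro q' p' hstep
  rw [add_comm, add_comm q'.totalDegree]
  refine hred p' q' ?_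
  cases hstep with
  | linear _ _ a b c d h =>
    rw [add_comm (a • q), add_comm (c • q)]
    exact .linear p q d c b a (by rwa [mul_comm d, mul_comm c])
  | left _ _ μ hμ j hj => exact .right p q μ hμ j hj
  | right _ _ μ hμ j hj => exact .left p q μ hμ j hj

theorem IsElementaryReduced.totalDegree_le_totalDegree_add_smul_pow
    (hred : IsElementaryReduced p q) (α : K) {c : ℕ} (hc : c ≠ 0) :
    q.totalDegree ≤ (q + α • p ^ c).totalDegree := by
  refine Nat.le_of_add_le_add_left (hred p _ ?_)
  rcases eq_or_ne α 0 with rfl | hα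
  · simpa using ElementaryStep.linear p q 1 0 0 1 (by simp)
  rcases eq_or_ne c 1 with rfl | hc1
  · simpa [add_comm] using ElementaryStep.linear p q 1 0 α 1 (by simp)
  · exact .right p q α hα c (by omega)

theorem IsElementaryReduced.not_leadingForm_pow_dvd (hred : IsElementaryReduced p q)
    (hq : 0 < q.totalDegree) {c : ℕ} (hc : q.totalDegree = p.totalDegree * c) :
    ¬ leadingForm 1 p ^ c ∣ leadingForm 1 q := by
  rintro ⟨z, hz⟩
  have hQ : leadingForm 1 p ^ c * z ≠ 0 :=
    hz ▸ leadingForm_ne_zero 1 (ne_zero_of_totalDegree_pos hq)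
  have hPhom : (leadingForm 1 p ^ c).IsHomogeneous (p.totalDegree * c) :=
    (isHomogeneous_leadingForm_one p).pow c
  have hzconst : z.totalDegree = 0 := by
    have hdeg := (isHomogeneous_leadingForm_one q).totalDegree (hz ▸ hQ)
    rw [hz, totalDegree_mul_of_isDomain (left_ne_zero_of_mul hQ) (right_ne_zero_of_mul hQ),
      hPhom.totalDegree (left_ne_zero_of_mul hQ)] at hdeg
    omega
  obtain ⟨α, rfl⟩ : ∃ α, z = C α := ⟨_, totalDegree_eq_zero_iff_eq_C.1 hzconst⟩
  have hpow : (p ^ c).totalDegree ≤ q.totalDegree := by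
    rw [hc, mul_comm]
    exact totalDegree_pow p c
  have hcancel : weightedHomogeneousComponent 1 q.totalDegree (q + (-α) • p ^ c) = 0 := by
    have hPc := weightedHomogeneousComponent_pow_of_le (weightedTotalDegree_one p).le c
    have hQtop : weightedHomogeneousComponent 1 q.totalDegree q = leadingForm 1 q := by
      rw [leadingForm, weightedTotalDegree_one]
    rw [mul_comm c, ← hc, ← weightedTotalDegree_one p, ← leadingForm] at hPc
    rw [map_add, map_smul, hPc, hQtop, hz, smul_eq_C_mul, C_neg]
    ring
  have hc0 : c ≠ 0 := by
    rintro rfl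
    omega
  have hdeg : (q + (-α) • p ^ c).totalDegree = q.totalDegree :=
    le_antisymm ((totalDegree_add _ _).trans (max_le le_rfl ((totalDegree_smul_le _ _).trans hpow)))
      (hred.totalDegree_le_totalDegree_add_smul_pow (-α) hc0)
  rw [← hdeg, ← weightedTotalDegree_one] at hcancel
  refine leadingForm_ne_zero 1 (ne_zero_of_totalDegree_pos ?_) hcancel
  rwa [hdeg]

end ElementaryReduced

theorem mainTheorem5_general {K : Type*} [Field K] [CharZero K] {p q w : MvPolynomial (Fin 2) K}
    (hred : IsElementaryReduced p q)
    (hw : w ∈ Algebra.adjoin K ({p, q} : Set (MvPolynomial (Fin 2) K)))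
    (hlin : ¬ ∃ a b c : K, w = a • p + b • q + C c) :
    min (min p.totalDegree q.totalDegree) (jacobianDet p q).totalDegree < w.totalDegree := by
  wlog hpq : p.totalDegree ≤ q.totalDegree generalizing p q
  · rw [min_comm p.totalDegree, ← totalDegree_neg (jacobianDet p q), ← jacobianDet_swap]
    refine this hred.symm (by rwa [Set.pair_comm]) (fun ⟨a, b, c, h⟩ => hlin ⟨b, a, c, ?_⟩)
      (le_of_not_ge hpq)
    rw [h, add_comm (a • q)]
  rw [min_eq_left hpq]
  by_cases hD : jacobianDet p q = 0
  · rw [hD, totalDegree_zero, Nat.min_zero, Nat.pos_iff_ne_zero]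
    exact fun hw0 => hlin ⟨0, 0, coeff 0 w, by simpa using totalDegree_eq_zero_iff_eq_C.1 hw0⟩
  have hp : 0 < p.totalDegree := totalDegree_left_pos_of_jacobianDet_ne_zero hD
  rw [show ({p, q} : Set _) = Set.range ![p, q] by simp [Set.pair_comm],
    Algebra.adjoin_range_eq_range_aeval] at hw
  obtain ⟨G, rfl⟩ := hw
  change _ < (aeval ![p, q] G).totalDegree
  have hweight : 2 * p.totalDegree ≤ weightedTotalDegree ![p.totalDegree, q.totalDegree] G :=
    not_lt.1 fun hlt => hlin (exists_aeval_eq_affine_of_weightedTotalDegree_lt hpq hlt p q)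
  have hG : G ≠ 0 := by
    rintro rfl
    rw [weightedTotalDegree_zero, Nat.bot_eq_zero] at hweight
    omega
  by_cases hk : leadingMultiplicity p q G = 0
  · have hestimate := weightedTotalDegree_add_leadingMultiplicity_mul_le hD hG
    rw [hk, zero_mul, zero_mul, add_zero, add_zero] at hestimate
    exact min_lt_of_left_lt (by omega)
  · refine min_lt_of_right_lt (totalDegree_jacobianDet_lt_totalDegree_aeval hpq ?_ hD hG hk)
    rintro ⟨c, hc⟩
    exact hred.not_leadingForm_pow_dvd (hp.trans_le hpq) hc
      (leadingForm_pow_dvd_leadingForm hp hG hc hk)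

theorem mainTheorem5 (p q : MvPolynomial (Fin 2) ℂ)
    (hind : AlgebraicIndependent ℂ ![p, q])
    (hred : IsElementaryReduced p q)
    (n m k : ℕ) (hn : p.totalDegree = n) (hm : q.totalDegree = m)
    (hn2 : 2 ≤ n) (hnm : n < m)
    (hk : k ≤ (jacobianDet p q).totalDegree)
    (w : MvPolynomial (Fin 2) ℂ)
    (hw : w ∈ Algebra.adjoin ℂ ({p, q} : Set (MvPolynomial (Fin 2) ℂ)))
    (hlin : ¬ ∃ a b c : ℂ, w = a • p + b • q + MvPolynomial.C c) :
    min n k < w.totalDegree :=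
  (min_le_min (by omega) hk).trans_lt (mainTheorem5_general hred hw hlin)
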